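/- Let $K$ be a field, $n\ge 3$, let $X=(x_{ij})$ and $Y=(y_{ij})$ be $n\times n$ matrices of indeterminates over $K$, and let $R=K[x_{ij},y_{ij} : 1\le i,j\le n]$ with its standard grading. Let $J\subset R$ be the (homogeneous) ideal generated by the anti-diagonal entries $c_{i,\,n+1-i}$ $(1\le i\le n)$ of the commutator matrix $C=XY-YX=(c_{ij})$. Then the $2n^2-n$ elements $$x_{ij}\ (2\le i\le n,\ 1\le j\le n),\qquad y_{ij}\ (1\le i\le n,\ 2\le j\le n),\qquad x_{1j}-y_{n-j+1,1}\ (1\le j\le n)$$ form, in any order, a homogeneous system of parameters and a regular sequence on $R/J$. (A homogeneous system of parameters of $R/J$ is a sequence of $\dim R/J$ homogeneous elements of positive degree such that the quotient of $R/J$ by the ideal they generate has Krull dimension $0$.) Moreover, if $L\subset R$ is the ideal generated by these elements, then there is an isomorphism of $K$-algebras from $R/L$ to the polynomial ring $K[x_{11},\dots,x_{1n}]$ that sends the class of $x_{1j}$ to $x_{1j}$ for every $j$ and maps the image of $J$ in $R/L$ onto the ideal $(x_{11}^2,\dots,x_{1n}^2)$. -/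

import Mathlib

noncomputable section

namespace CommutatorMatrix

open MvPolynomial

section Graded

variable {K A : Type*} [Field K] [CommRing A] [Algebra K A]

/-- The degree `d` part of `A / I`, the image of the degree `d` part of `A`. -/
def quotientGrading (𝒜 : ℕ → Submodule K A) (I : Ideal A) (d : ℕ) : Submodule K (A ⧸ I) :=
  (𝒜 d).map (Ideal.Quotient.mkₐ K I).toLinearMap

theorem quotientGrading_gradedMonoid (𝒜 : ℕ → Submodule K A) [SetLike.GradedMonoid 𝒜]
    (I : Ideal A) : SetLike.GradedMonoid (quotientGrading 𝒜 I) where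
  one_mem := ⟨1, SetLike.GradedOne.one_mem, map_one (Ideal.Quotient.mkₐ K I)⟩
  mul_mem := by
    rintro i j _ _ ⟨a, ha, rfl⟩ ⟨b, hb, rfl⟩
    exact ⟨a * b, SetLike.GradedMul.mul_mem ha hb, map_mul (Ideal.Quotient.mkₐ K I) a b⟩

/-- The decomposition of `a : A` into homogeneous components, reduced modulo `I`. -/
def quotientDecompose (𝒜 : ℕ → Submodule K A) [GradedAlgebra 𝒜] (I : Ideal A) :
    A →ₗ[K] DirectSum ℕ fun d => quotientGrading 𝒜 I d :=
  (DirectSum.lmap fun d => (Ideal.Quotient.mkₐ K I).toLinearMap.submoduleMap (𝒜 d)) ∘ₗ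
    (DirectSum.decomposeLinearEquiv 𝒜).toLinearMap

theorem quotientDecompose_apply (𝒜 : ℕ → Submodule K A) [GradedAlgebra 𝒜] (I : Ideal A)
    (a : A) (d : ℕ) : ((quotientDecompose 𝒜 I a d : quotientGrading 𝒜 I d) : A ⧸ I) =
      Ideal.Quotient.mk I (DirectSum.decompose 𝒜 a d : A) := by
  rfl

theorem quotientDecompose_eq_zero (𝒜 : ℕ → Submodule K A) [GradedAlgebra 𝒜] {I : Ideal A}
    (hI : I.IsHomogeneous 𝒜) (a : A) (ha : a ∈ I) : quotientDecompose 𝒜 I a = 0 := by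
  refine DFinsupp.ext fun d => Subtype.ext ?_
  rw [quotientDecompose_apply]
  exact Ideal.Quotient.eq_zero_iff_mem.2 (hI d ha)

theorem quotientDecompose_of_mem (𝒜 : ℕ → Submodule K A) [GradedAlgebra 𝒜] (I : Ideal A)
    {a : A} {d : ℕ} (ha : a ∈ 𝒜 d) : quotientDecompose 𝒜 I a =
      DirectSum.of (fun d => quotientGrading 𝒜 I d) d
        ⟨Ideal.Quotient.mk I a, Submodule.mem_map_of_mem ha⟩ := by
  refine DFinsupp.ext fun e => Subtype.ext ?_
  rw [quotientDecompose_apply, DirectSum.decompose_of_mem 𝒜 ha]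
  by_cases h : d = e
  · subst h
    rw [DirectSum.of_eq_same, DirectSum.of_eq_same]
  · rw [DirectSum.of_eq_of_ne _ _ _ (Ne.symm h), DirectSum.of_eq_of_ne _ _ _ (Ne.symm h)]
    exact map_zero _

theorem quotientDecompose_surjective (𝒜 : ℕ → Submodule K A) [GradedAlgebra 𝒜] (I : Ideal A) :
    Function.Surjective (quotientDecompose 𝒜 I) := by
  intro z
  induction z using DirectSum.induction_on with
  | zero => exact ⟨0, map_zero _⟩
  | of d x =>
    obtain ⟨_, a, ha, rfl⟩ := x
    exact ⟨a, quotientDecompose_of_mem 𝒜 I ha⟩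
  | add x y hx hy =>
    obtain ⟨a, rfl⟩ := hx
    obtain ⟨b, rfl⟩ := hy
    exact ⟨a + b, map_add _ _ _⟩

theorem coe_quotientDecompose (𝒜 : ℕ → Submodule K A) [GradedAlgebra 𝒜] (I : Ideal A) (a : A) :
    DirectSum.coeAddMonoidHom (quotientGrading 𝒜 I) (quotientDecompose 𝒜 I a) =
      Ideal.Quotient.mk I a := by
  refine DirectSum.Decomposition.inductionOn 𝒜 (by simp) (fun {d} x => ?_)
    (fun x y hx hy => by rw [map_add, map_add, hx, hy, map_add]) a
  rw [quotientDecompose_of_mem 𝒜 I x.2]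
  exact DirectSum.coeAddMonoidHom_of _ _ _

/-- The quotient of a graded algebra by a homogeneous ideal is graded. -/
@[reducible] def quotientGradedAlgebra (𝒜 : ℕ → Submodule K A) [GradedAlgebra 𝒜] {I : Ideal A}
    (hI : I.IsHomogeneous 𝒜) : GradedAlgebra (quotientGrading 𝒜 I) where
  toGradedMonoid := quotientGrading_gradedMonoid 𝒜 I
  decompose' x := quotientDecompose 𝒜 I x.out
  left_inv x := (coe_quotientDecompose 𝒜 I _).trans (Ideal.Quotient.mk_out x)
  right_inv z := by
    obtain ⟨a, rfl⟩ := quotientDecompose_surjective 𝒜 I z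
    rw [coe_quotientDecompose]
    refine sub_eq_zero.1 ((map_sub (quotientDecompose 𝒜 I) _ _).symm.trans ?_)
    exact quotientDecompose_eq_zero 𝒜 hI _
      (Ideal.Quotient.eq.1 (Ideal.Quotient.mk_out (Ideal.Quotient.mk I a)))

/-- A homogeneous system of parameters of an `ℕ`-graded `K`-algebra `A`: homogeneous elements of
positive degree, as many as the Krull dimension of `A`, modulo which `A` has Krull dimension
zero. -/
structure IsHomogeneousSystemOfParameters (𝒜 : ℕ → Submodule K A) [GradedAlgebra 𝒜]
    (fs : List A) : Prop where
  homogeneous : ∀ f ∈ fs, ∃ d, 0 < d ∧ f ∈ 𝒜 d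
  length_eq : ringKrullDim A = fs.length
  dim_quotient : ringKrullDim (A ⧸ Ideal.ofList fs) = 0

end Graded

variable (K : Type*) [Field K] (n : ℕ)

/-- The polynomial ring `K[X, Y]` in the entries of two `n × n` matrices; the variables
`Sum.inl (i, j)` and `Sum.inr (i, j)` are `x_{ij}` and `y_{ij}`, with indices from `0`. -/
abbrev PolyRing : Type _ := MvPolynomial ((Fin n × Fin n) ⊕ (Fin n × Fin n)) K

/-- The generic matrix `(x_{ij})`. -/
def matX : Matrix (Fin n) (Fin n) (PolyRing K n) := Matrix.of fun i j => X (Sum.inl (i, j))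

/-- The generic matrix `(y_{ij})`. -/
def matY : Matrix (Fin n) (Fin n) (PolyRing K n) := Matrix.of fun i j => X (Sum.inr (i, j))

/-- The commutator matrix `XY - YX`. -/
def commMatrix : Matrix (Fin n) (Fin n) (PolyRing K n) :=
  matX K n * matY K n - matY K n * matX K n

/-- The ideal `J` generated by the anti-diagonal entries of the commutator matrix. -/
def antiDiagIdeal : Ideal (PolyRing K n) :=
  Ideal.span (Set.range fun i : Fin n => commMatrix K n i i.rev)

theorem isHomogeneous_commMatrix (i j : Fin n) : (commMatrix K n i j).IsHomogeneous 2 := by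
  simp only [commMatrix, matX, matY, Matrix.sub_apply, Matrix.mul_apply, Matrix.of_apply]
  exact (IsHomogeneous.sum _ _ _ fun k _ => (isHomogeneous_X K _).mul (isHomogeneous_X K _)).sub
    (IsHomogeneous.sum _ _ _ fun k _ => (isHomogeneous_X K _).mul (isHomogeneous_X K _))

/-- The grading of `R / J` induced by the standard grading of the polynomial ring `R`. -/
abbrev antiDiagGrading : ℕ → Submodule K (PolyRing K n ⧸ antiDiagIdeal K n) :=
  quotientGrading (homogeneousSubmodule ((Fin n × Fin n) ⊕ (Fin n × Fin n)) K)
    (antiDiagIdeal K n)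

instance antiDiagGradedAlgebra : GradedAlgebra (antiDiagGrading K n) :=
  letI := MvPolynomial.gradedAlgebra (σ := (Fin n × Fin n) ⊕ (Fin n × Fin n)) (R := K)
  quotientGradedAlgebra _ (I := antiDiagIdeal K n) (by
    refine Ideal.homogeneous_span _ _ ?_
    rintro _ ⟨i, rfl⟩
    exact ⟨2, isHomogeneous_commMatrix K n i i.rev⟩)

/-- The elements `x_{ij}` outside the first row of `X`, `y_{ij}` outside the first column of `Y`,
and `x_{1j} - y_{n-j+1,1}`, written with indices from `0`. -/
def parameterList [NeZero n] : List (PolyRing K n) :=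
  ((List.finRange n ×ˢ List.finRange n).filter fun p => p.1 ≠ 0).map
      (fun p => matX K n p.1 p.2) ++
    ((List.finRange n ×ˢ List.finRange n).filter fun p => p.2 ≠ 0).map
      (fun p => matY K n p.1 p.2) ++
    (List.finRange n).map fun j => matX K n 0 j - matY K n j.rev 0

end CommutatorMatrix

end

/-!
Modulo the parameters, `X` is supported on its first row and `Y` on its first column, with
`y_{n-j+1,1}` identified with `x_{1j}`; so `R` becomes `K[x_{11}, …, x_{1n}]`, and since no
anti-diagonal entry of `XY` lies at the corner `(1, 1)`, the entry `c_{i,n+1-i}` becomes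
`-x_{1,n+1-i}²`. Up to a linear change of variables the parameters followed by these squares are
powers of distinct variables, hence a regular sequence; replacing the squares by the congruent
`c_{i,n+1-i}` keeps it regular. All elements being homogeneous of positive degree, the graded
Nakayama lemma permits any reordering, in particular the `c_{i,n+1-i}` first and then the
parameters in any order. As this sequence has `2n² = dim R` elements, and dividing by a regular
element lowers the dimension by at least one, the dimensions of both quotients are forced.
-/

noncomputable section

namespace CommutatorMatrix

open RingTheory.Sequence
open scoped Pointwise

section GradedModule

variable {A M σ τ : Type*} [CommRing A] [AddCommGroup M] [Module A M] [SetLike σ A] [SetLike τ M]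
  [AddSubmonoidClass τ M] {𝒜 : ℕ → σ} {ℳ : ℕ → τ} [DirectSum.Decomposition ℳ]
  [SetLike.GradedSMul 𝒜 ℳ]

theorem coe_decompose_smul_of_lt {a : A} {d e : ℕ} (ha : a ∈ 𝒜 d) (hed : e < d) (m : M) :
    (DirectSum.decompose ℳ (a • m) e : M) = 0 := by
  induction m using DirectSum.Decomposition.inductionOn ℳ with
  | zero => simp
  | @homogeneous i m =>
    exact DirectSum.decompose_of_mem_ne ℳ (SetLike.GradedSMul.smul_mem ha m.2)
      (show d + i ≠ e by omega)
  | add m m' hm hm' => simp [smul_add, hm, hm']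

variable [AddSubmonoidClass σ A] [GradedRing 𝒜]

theorem isHomogeneous_smul {I : Ideal A} {N : Submodule A M} (hI : I.IsHomogeneous 𝒜)
    (hN : N.IsHomogeneous ℳ) : (I • N).IsHomogeneous ℳ := by
  classical
  intro e x hx
  refine Submodule.smul_induction_on hx (fun r hr m hm => ?_) fun x y hx hy => by
    simpa using add_mem hx hy
  rw [← DirectSum.sum_support_decompose 𝒜 r, ← DirectSum.sum_support_decompose ℳ m,
    Finset.sum_smul_sum, DirectSum.decompose_sum, DFinsupp.finsetSum_apply,
    AddSubmonoidClass.coe_finsetSum]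
  refine sum_mem fun i _ => ?_
  rw [DirectSum.decompose_sum, DFinsupp.finsetSum_apply, AddSubmonoidClass.coe_finsetSum]
  refine sum_mem fun j _ => ?_
  have hij := SetLike.GradedSMul.smul_mem (DirectSum.decompose 𝒜 r i).2
    (DirectSum.decompose ℳ m j).2
  rw [DirectSum.decompose_of_mem ℳ hij, DirectSum.coe_of_apply]
  split_ifs
  · exact Submodule.smul_mem_smul (hI i hr) (hN j hm)
  · exact zero_mem _

theorem eq_bot_of_le_smul {P : Submodule A M} (hP : P.IsHomogeneous ℳ) {a : A} {d : ℕ}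
    (hd : 0 < d) (ha : a ∈ 𝒜 d) {N : Submodule A (M ⧸ P)} (hN : N ≤ a • N) : N = ⊥ := by
  rw [eq_bot_iff]
  intro x hx
  obtain ⟨m, rfl⟩ := P.mkQ_surjective x
  suffices ∀ e, (DirectSum.decompose ℳ m e : M) ∈ P by
    simpa using (hP.mem_iff ℳ).2 this
  intro e
  obtain ⟨y, -, hy⟩ := le_pow_smul hN (e + 1) hx
  obtain ⟨m', rfl⟩ := P.mkQ_surjective y
  have hsub : m - a ^ (e + 1) • m' ∈ P := by
    rw [← Submodule.Quotient.eq]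
    exact hy.symm
  have hvanish : (DirectSum.decompose ℳ (a ^ (e + 1) • m') e : M) = 0 :=
    coe_decompose_smul_of_lt (SetLike.pow_mem_graded (e + 1) ha) (by rw [smul_eq_mul]; nlinarith) m'
  rw [← sub_add_cancel m (a ^ (e + 1) • m'), DirectSum.decompose_add, DirectSum.add_apply,
    AddMemClass.coe_add, hvanish, add_zero]
  exact hP e hsub

end GradedModule

theorem isWeaklyRegular_of_perm {A M σ τ : Type*} [CommRing A] [AddCommGroup M] [Module A M]
    [SetLike σ A] [AddSubmonoidClass σ A] (𝒜 : ℕ → σ) [GradedRing 𝒜] [SetLike τ M]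
    [AddSubmonoidClass τ M] (ℳ : ℕ → τ) [DirectSum.Decomposition ℳ] [SetLike.GradedSMul 𝒜 ℳ]
    {rs ss : List A} (h : IsWeaklyRegular M rs) (hperm : rs.Perm ss)
    (hrs : ∀ r ∈ rs, ∃ d, 0 < d ∧ r ∈ 𝒜 d) : IsWeaklyRegular M ss := by
  refine h.prototype_perm hperm fun a b ts hts => ?_
  obtain ⟨d, hd, had⟩ := hrs a (hts.subset (by simp))
  have hI : (Ideal.ofList ts).IsHomogeneous 𝒜 := Ideal.homogeneous_span _ _ fun r hr => by
    obtain ⟨e, -, he⟩ := hrs r (hts.subset (by simp [show r ∈ ts from hr]))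
    exact ⟨e, he⟩
  have hP : (Ideal.ofList ts • (⊤ : Submodule A M)).IsHomogeneous ℳ :=
    isHomogeneous_smul hI fun _ _ _ => Submodule.mem_top
  exact fun hK => eq_bot_of_le_smul hP hd had hK.le

theorem ofList_ne_top_of_homogeneous {A σ : Type*} [CommRing A] [Nontrivial A] [SetLike σ A]
    [AddSubmonoidClass σ A] (𝒜 : ℕ → σ) [GradedRing 𝒜] {rs : List A}
    (hrs : ∀ r ∈ rs, ∃ d, 0 < d ∧ r ∈ 𝒜 d) : Ideal.ofList rs ≠ ⊤ := by
  have hirr : Ideal.ofList rs ≤ (HomogeneousIdeal.irrelevant 𝒜).toIdeal :=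
    Ideal.span_le.2 fun r hr => by
      obtain ⟨d, hd, hrd⟩ := hrs r hr
      exact HomogeneousIdeal.mem_irrelevant_of_mem 𝒜 hd hrd
  refine ne_top_of_le_ne_top ((Ideal.ne_top_iff_one _).2 fun h1 => ?_) hirr
  rw [HomogeneousIdeal.mem_iff, HomogeneousIdeal.mem_irrelevant_iff, GradedRing.proj_apply,
    DirectSum.decompose_of_mem_same 𝒜 SetLike.GradedOne.one_mem] at h1
  exact one_ne_zero h1

section RegularSequence

variable {A M : Type*} [CommRing A] [AddCommGroup M] [Module A M]

theorem isWeaklyRegular_of_forall₂_associated {rs ss : List A} (h : IsWeaklyRegular M rs)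
    (hrs : List.Forall₂ Associated rs ss) : IsWeaklyRegular M ss := by
  induction hrs generalizing M with
  | nil => exact .nil A M
  | @cons r s rs ss hrs _ ih =>
    obtain ⟨hr, h⟩ := (isWeaklyRegular_cons_iff _ _ _).1 h
    obtain ⟨u, rfl⟩ := hrs
    have heq : r • (⊤ : Submodule A M) = (r * (u : A)) • ⊤ := by
      rw [← Submodule.ideal_span_singleton_smul, ← Submodule.ideal_span_singleton_smul,
        Ideal.span_singleton_mul_right_unit u.isUnit]
    exact .cons (hr.mul (u.isUnit.isSMulRegular M))
      (ih (((Submodule.quotEquivOfEq _ _ heq).isWeaklyRegular_congr rs).1 h))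

theorem isWeaklyRegular_append_of_forall₂_associated_mk {rs ss ts : List A}
    (h : IsWeaklyRegular M (rs ++ ss))
    (hst : List.Forall₂ (fun s t => Associated (Ideal.Quotient.mk (Ideal.ofList rs) s)
      (Ideal.Quotient.mk (Ideal.ofList rs) t)) ss ts) :
    IsWeaklyRegular M (rs ++ ts) := by
  rw [isWeaklyRegular_append_iff'] at h ⊢
  refine ⟨h.1, isWeaklyRegular_of_forall₂_associated h.2 ?_⟩
  rwa [List.forall₂_map_left_iff, List.forall₂_map_right_iff]

theorem isRegular_self_iff {rs : List A} :
    IsRegular A rs ↔ IsWeaklyRegular A rs ∧ Ideal.ofList rs ≠ ⊤ := by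
  rw [isRegular_iff, smul_eq_mul, Ideal.mul_top, ne_comm]

theorem isRegular_map_mk_of_append {rs ss : List A} (h : IsRegular A (rs ++ ss)) :
    IsRegular (A ⧸ Ideal.ofList rs) (ss.map (Ideal.Quotient.mk (Ideal.ofList rs))) := by
  rw [isRegular_self_iff, isWeaklyRegular_append_iff] at h
  obtain ⟨⟨-, hweak⟩, hne⟩ := h
  have heq : Ideal.ofList rs • (⊤ : Ideal A) = Ideal.ofList rs := by simp
  refine isRegular_self_iff.2 ⟨(isWeaklyRegular_map_algebraMap_iff (A ⧸ Ideal.ofList rs) _ ss).2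
    (((Submodule.quotEquivOfEq _ _ heq).isWeaklyRegular_congr ss).1 hweak), fun htop => hne ?_⟩
  rw [Ideal.ofList_append, ← Ideal.comap_map_quotientMk, Ideal.map_ofList, htop, Ideal.comap_top]

theorem supportDim_quotient_add_length_le [Module.Finite A M] {rs : List A}
    (h : IsWeaklyRegular M rs) :
    Module.supportDim A (M ⧸ Ideal.ofList rs • (⊤ : Submodule A M)) + rs.length ≤
      Module.supportDim A M := by
  induction rs generalizing M with
  | nil =>
    rw [Ideal.ofList_nil, Submodule.bot_smul]
    simpa using (Module.supportDim_eq_of_equiv (Submodule.quotEquivOfEqBot ⊥ rfl)).le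
  | cons r rs ih =>
    obtain ⟨hr, hrs⟩ := (isWeaklyRegular_cons_iff _ _ _).1 h
    rw [Module.supportDim_eq_of_equiv (Submodule.quotOfListConsSMulTopEquivQuotSMulTopInner M r rs)]
    calc
      _ = Module.supportDim A (QuotSMulTop r M ⧸ Ideal.ofList rs • (⊤ : Submodule A _)) +
          rs.length + 1 := by rw [List.length_cons, Nat.cast_succ, add_assoc]
      _ ≤ Module.supportDim A (QuotSMulTop r M) + 1 := by gcongr; exact ih hrs
      _ ≤ Module.supportDim A M := Module.supportDim_quotSMulTop_succ_le_of_notMem_minimalPrimes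
          fun _ => hr.notMem_of_mem_minimalPrimes

theorem ringKrullDim_quotient_add_length_le {rs : List A} (h : IsWeaklyRegular A rs) :
    ringKrullDim (A ⧸ Ideal.ofList rs) + rs.length ≤ ringKrullDim A := by
  have heq : Ideal.ofList rs = Ideal.ofList rs • (⊤ : Ideal A) := by simp
  rw [ringKrullDim_eq_of_ringEquiv (Ideal.quotEquivOfEq heq),
    ← Module.supportDim_quotient_eq_ringKrullDim, ← Module.supportDim_self_eq_ringKrullDim]
  exact supportDim_quotient_add_length_le h

theorem ringKrullDim_quotient_eq_zero {rs : List A} (h : IsRegular A rs)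
    (hdim : ringKrullDim A = rs.length) : ringKrullDim (A ⧸ Ideal.ofList rs) = 0 := by
  have : Nontrivial (A ⧸ Ideal.ofList rs) :=
    Ideal.Quotient.nontrivial_iff.2 (isRegular_self_iff.1 h).2
  refine le_antisymm ?_ ringKrullDim_nonneg_of_nontrivial
  rw [← ENat.WithBot.add_le_add_natCast_right_iff (c := rs.length), zero_add]
  exact (ringKrullDim_quotient_add_length_le h.toIsWeaklyRegular).trans_eq hdim

theorem ringKrullDim_quotient_eq_length_of_append {rs ss : List A} (h : IsRegular A (rs ++ ss))
    (hdim : ringKrullDim A = (rs ++ ss).length) :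
    ringKrullDim (A ⧸ Ideal.ofList rs) = ss.length := by
  apply le_antisymm
  · rw [← ENat.WithBot.add_le_add_natCast_right_iff (c := rs.length), ← Nat.cast_add,
      add_comm ss.length, ← List.length_append, ← hdim]
    exact ringKrullDim_quotient_add_length_le ((isWeaklyRegular_append_iff _ _ _).1 h.1).1
  · have hss := isRegular_map_mk_of_append h
    have : Nontrivial (_ ⧸ Ideal.ofList (ss.map (Ideal.Quotient.mk (Ideal.ofList rs)))) :=
      Ideal.Quotient.nontrivial_iff.2 (isRegular_self_iff.1 hss).2
    rw [← List.length_map (Ideal.Quotient.mk (Ideal.ofList rs)), ← zero_add (Nat.cast _)]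
    exact (add_le_add_left ringKrullDim_nonneg_of_nontrivial _).trans
      (ringKrullDim_quotient_add_length_le hss.toIsWeaklyRegular)

end RegularSequence

section Monomial

open MvPolynomial

theorem isWeaklyRegular_X_pow {σ R : Type*} [CommRing R] (l : List (σ × ℕ))
    (hl : (l.map Prod.fst).Nodup) :
    IsWeaklyRegular (MvPolynomial σ R) (l.map fun p => (X p.1 : MvPolynomial σ R) ^ p.2) := by
  induction l using List.reverseRecOn with
  | nil => exact .nil _ _
  | append_singleton l p ih =>
    rw [List.map_append, List.map_singleton, List.nodup_append] at hl
    rw [List.map_append, List.map_singleton, isWeaklyRegular_append_iff,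
      isWeaklyRegular_singleton_iff, isSMulRegular_quotient_iff_mem_of_smul_mem]
    have hI : Ideal.ofList (l.map fun p => (X p.1 : MvPolynomial σ R) ^ p.2) =
        Ideal.span ((fun s => monomial s (1 : R)) ''
          {s | ∃ q ∈ l, Finsupp.single q.1 q.2 = s}) := by
      refine congrArg Ideal.span (Set.ext fun f => ?_)
      simp [X_pow_eq_monomial]
    rw [smul_eq_mul, Ideal.mul_top, hI]
    refine ⟨ih hl.1, fun f hf => ?_⟩
    rw [mem_ideal_span_monomial_image] at hf ⊢
    intro m hm
    have hmp : m + Finsupp.single p.1 p.2 ∈ ((X p.1 : MvPolynomial σ R) ^ p.2 • f).support := by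
      rwa [mem_support_iff, smul_eq_mul, X_pow_eq_monomial, mul_comm, coeff_mul_monomial, mul_one,
        ← mem_support_iff]
    obtain ⟨_, ⟨q, hq, rfl⟩, hle⟩ := hf _ hmp
    have hne : p.1 ≠ q.1 := fun e =>
      hl.2.2 q.1 (List.mem_map_of_mem hq) p.1 (by simp) e.symm
    refine ⟨_, ⟨q, hq, rfl⟩, ?_⟩
    rw [Finsupp.single_le_iff] at hle ⊢
    simpa [Finsupp.single_apply, hne] using hle

end Monomial

section Commutator

open MvPolynomial

variable (K : Type*) [Field K] (n : ℕ)

/-- The anti-diagonal entries of the commutator matrix, listed from the top row down. -/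
def antiDiagList : List (PolyRing K n) := (List.finRange n).map fun i => commMatrix K n i i.rev

theorem ofList_antiDiagList : Ideal.ofList (antiDiagList K n) = antiDiagIdeal K n :=
  congrArg Ideal.span (Set.ext fun f => by simp [antiDiagList])

variable {K n} in
theorem isHomogeneous_of_mem_antiDiagList {f : PolyRing K n} (hf : f ∈ antiDiagList K n) :
    f.IsHomogeneous 2 := by
  obtain ⟨i, -, rfl⟩ := List.mem_map.1 hf
  exact isHomogeneous_commMatrix K n i i.rev

variable [NeZero n]

variable {K n} in
theorem isHomogeneous_of_mem_parameterList {f : PolyRing K n} (hf : f ∈ parameterList K n) :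
    f.IsHomogeneous 1 := by
  simp only [parameterList, List.mem_append, List.mem_map] at hf
  rcases hf with (⟨p, -, rfl⟩ | ⟨p, -, rfl⟩) | ⟨j, -, rfl⟩
  · exact isHomogeneous_X K _
  · exact isHomogeneous_X K _
  · exact (isHomogeneous_X K _).sub (isHomogeneous_X K _)

/-! ### The quotient by the parameters -/

/-- The substitution that kills the variables off the first row of `X` and off the first column
of `Y`, and sends both `x_{1j}` and `y_{n-j+1,1}` to the `j`-th variable, on variables. -/
def restrictVar : (Fin n × Fin n) ⊕ (Fin n × Fin n) → MvPolynomial (Fin n) K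
  | Sum.inl p => if p.1 = 0 then X p.2 else 0
  | Sum.inr p => if p.2 = 0 then X p.1.rev else 0

/-- The substitution `restrictVar` as an algebra homomorphism; its kernel is the ideal generated
by the parameters. -/
def restrict : PolyRing K n →ₐ[K] MvPolynomial (Fin n) K := aeval (restrictVar K n)

@[simp]
theorem restrict_matX (i j : Fin n) :
    restrict K n (matX K n i j) = if i = 0 then X j else 0 := by
  simp [restrict, matX, restrictVar]

@[simp]
theorem restrict_matY (i j : Fin n) :
    restrict K n (matY K n i j) = if j = 0 then X i.rev else 0 := by
  simp [restrict, matY, restrictVar]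

theorem ofList_parameterList_le_ker_restrict :
    Ideal.ofList (parameterList K n) ≤ RingHom.ker (restrict K n) := by
  refine Ideal.span_le.2 fun f hf => ?_
  simp only [parameterList, Set.mem_ofPred_eq, List.mem_append, List.mem_map, List.mem_filter] at hf
  rw [SetLike.mem_coe, RingHom.mem_ker]
  rcases hf with (⟨p, ⟨-, hp⟩, rfl⟩ | ⟨p, ⟨-, hp⟩, rfl⟩) | ⟨j, -, rfl⟩
  · simpa using hp
  · simpa using hp
  · simp

variable {n} in
theorem mk_matX_of_ne_zero {i : Fin n} (hi : i ≠ 0) (j : Fin n) :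
    Ideal.Quotient.mk (Ideal.ofList (parameterList K n)) (matX K n i j) = 0 :=
  Ideal.Quotient.eq_zero_iff_mem.2 <| Ideal.subset_span <| List.mem_append_left _ <|
    List.mem_append_left _ <| List.mem_map.2 ⟨(i, j), by simp [hi], rfl⟩

variable {n} in
theorem mk_matY_of_ne_zero (i : Fin n) {j : Fin n} (hj : j ≠ 0) :
    Ideal.Quotient.mk (Ideal.ofList (parameterList K n)) (matY K n i j) = 0 :=
  Ideal.Quotient.eq_zero_iff_mem.2 <| Ideal.subset_span <| List.mem_append_left _ <|
    List.mem_append_right _ <| List.mem_map.2 ⟨(i, j), by simp [hj], rfl⟩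

variable {n} in
theorem mk_matX_zero_rev (i : Fin n) :
    Ideal.Quotient.mk (Ideal.ofList (parameterList K n)) (matX K n 0 i.rev) =
      Ideal.Quotient.mk _ (matY K n i 0) :=
  Ideal.Quotient.eq.2 <| Ideal.subset_span <| List.mem_append_right _ <|
    List.mem_map.2 ⟨i.rev, by simp, by simp⟩

/-- The isomorphism from the quotient by the parameters to the polynomial ring in the first row
of `X`, induced by `restrict`. -/
def parameterQuotientEquiv :
    (PolyRing K n ⧸ Ideal.ofList (parameterList K n)) ≃ₐ[K] MvPolynomial (Fin n) K :=
  AlgEquiv.ofAlgHom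
    (Ideal.Quotient.liftₐ _ (restrict K n) fun _ hf => ofList_parameterList_le_ker_restrict K n hf)
    (aeval fun j => Ideal.Quotient.mk _ (matX K n 0 j))
    (by
      ext1 j
      rw [AlgHom.comp_apply, aeval_X]
      exact (restrict_matX K n 0 j).trans (if_pos rfl))
    (by
      refine Ideal.Quotient.algHom_ext _ (MvPolynomial.algHom_ext fun v => ?_)
      rcases v with ⟨i, j⟩ | ⟨i, j⟩
      · change aeval _ (restrict K n (matX K n i j)) = Ideal.Quotient.mk _ (matX K n i j)
        by_cases hi : i = 0
        · simp [hi]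
        · simp [hi, mk_matX_of_ne_zero K hi j]
      · change aeval _ (restrict K n (matY K n i j)) = Ideal.Quotient.mk _ (matY K n i j)
        by_cases hj : j = 0
        · simp [hj, mk_matX_zero_rev K i]
        · simp [hj, mk_matY_of_ne_zero K i hj])

@[simp]
theorem parameterQuotientEquiv_mk (f : PolyRing K n) :
    parameterQuotientEquiv K n (Ideal.Quotient.mk _ f) = restrict K n f := rfl

variable {n} in
theorem restrict_commMatrix_rev (hn : 2 ≤ n) (i : Fin n) :
    restrict K n (commMatrix K n i i.rev) = -X i.rev ^ 2 := by
  have hrev : i = 0 → i.rev ≠ 0 := by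
    rintro rfl h
    have := congrArg Fin.val h
    simp only [Fin.val_rev, Fin.val_zero] at this
    omega
  have hXY : restrict K n ((matX K n * matY K n) i i.rev) = 0 := by
    rw [Matrix.mul_apply, map_sum]
    refine Finset.sum_eq_zero fun k _ => ?_
    by_cases hi : i = 0
    · simp [hrev hi]
    · simp [hi]
  have hYX : restrict K n ((matY K n * matX K n) i i.rev) = X i.rev ^ 2 := by
    simp [Matrix.mul_apply, sq]
  rw [commMatrix, Matrix.sub_apply, map_sub, hXY, hYX, zero_sub]

variable {n} in
theorem mk_matX_zero_rev_sq (hn : 2 ≤ n) (i : Fin n) :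
    Ideal.Quotient.mk (Ideal.ofList (parameterList K n)) (matX K n 0 i.rev ^ 2) =
      -Ideal.Quotient.mk _ (commMatrix K n i i.rev) := by
  rw [← map_neg]
  refine (parameterQuotientEquiv K n).injective ?_
  rw [parameterQuotientEquiv_mk, parameterQuotientEquiv_mk, map_neg, restrict_commMatrix_rev K hn]
  simp

variable {n} in
theorem map_parameterQuotientEquiv_antiDiagIdeal (hn : 2 ≤ n) :
    ((antiDiagIdeal K n).map (Ideal.Quotient.mk (Ideal.ofList (parameterList K n)))).map
        (parameterQuotientEquiv K n) =
      Ideal.span (Set.range fun j : Fin n => (X j : MvPolynomial (Fin n) K) ^ 2) := by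
  rw [antiDiagIdeal, Ideal.map_span, Ideal.map_span, ← Set.range_comp, ← Set.range_comp,
    Ideal.span_range_eq_iSup, Ideal.span_range_eq_iSup]
  refine Fin.revPerm.iSup_congr fun i => ?_
  simp [restrict_commMatrix_rev K hn, Ideal.span_singleton_neg]

/-! ### Regularity of the parameters followed by the squares -/

/-- The involution of `K[X, Y]` that replaces `y_{i1}` by `x_{1,n+1-i} - y_{i1}`, on variables. -/
def shearVar : (Fin n × Fin n) ⊕ (Fin n × Fin n) → PolyRing K n
  | Sum.inl p => X (Sum.inl p)
  | Sum.inr p => if p.2 = 0 then X (Sum.inl (0, p.1.rev)) - X (Sum.inr p) else X (Sum.inr p)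

theorem aeval_shearVar_comp_self :
    (aeval (shearVar K n)).comp (aeval (shearVar K n)) = AlgHom.id K (PolyRing K n) := by
  ext1 v
  rcases v with p | ⟨i, j⟩
  · simp [shearVar]
  · by_cases hj : j = 0 <;> simp [shearVar, hj]

/-- The involution `shearVar` as an algebra automorphism; it turns the parameters into
variables. -/
def shear : PolyRing K n ≃ₐ[K] PolyRing K n :=
  AlgEquiv.ofAlgHom (aeval (shearVar K n)) (aeval (shearVar K n))
    (aeval_shearVar_comp_self K n) (aeval_shearVar_comp_self K n)

@[simp]
theorem shear_X (v : (Fin n × Fin n) ⊕ (Fin n × Fin n)) : shear K n (X v) = shearVar K n v :=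
  aeval_X _ v

/-- The variables corresponding to `parameterList` under `shear`, in the same order. -/
def parameterVars : List ((Fin n × Fin n) ⊕ (Fin n × Fin n)) :=
  ((List.finRange n ×ˢ List.finRange n).filter fun p => p.1 ≠ 0).map Sum.inl ++
    ((List.finRange n ×ˢ List.finRange n).filter fun p => p.2 ≠ 0).map Sum.inr ++
    (List.finRange n).map fun j => Sum.inr (j.rev, 0)

/-- The variables `x_{1,n+1-i}`, whose squares match `antiDiagList` modulo the parameters, in the
same order. -/
def rowVars : List ((Fin n × Fin n) ⊕ (Fin n × Fin n)) :=
  (List.finRange n).map fun i => Sum.inl (0, i.rev)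

theorem mem_parameterVars_append_rowVars (v : (Fin n × Fin n) ⊕ (Fin n × Fin n)) :
    v ∈ parameterVars n ++ rowVars n := by
  rcases v with ⟨i, j⟩ | ⟨i, j⟩
  · by_cases hi : i = 0
    · exact List.mem_append_right _ (List.mem_map.2 ⟨j.rev, by simp, by simp [hi]⟩)
    · simp [parameterVars, hi]
  · by_cases hj : j = 0
    · exact List.mem_append_left _ (List.mem_append_right _
        (List.mem_map.2 ⟨i.rev, by simp, by simp [hj]⟩))
    · simp [parameterVars, hj]

theorem nodup_parameterVars_append_rowVars : (parameterVars n ++ rowVars n).Nodup := by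
  have hp : (List.finRange n ×ˢ List.finRange n).Nodup :=
    (List.nodup_finRange n).product (List.nodup_finRange n)
  rw [parameterVars, rowVars, List.nodup_append', List.nodup_append', List.nodup_append']
  refine ⟨⟨⟨(hp.filter _).map Sum.inl_injective, (hp.filter _).map Sum.inr_injective, ?_⟩,
    (List.nodup_finRange n).map fun i j h => by simpa using h, ?_⟩,
    (List.nodup_finRange n).map fun i j h => by simpa using h, ?_⟩ <;>
  · intro v hv hv'
    simp only [List.mem_append, List.mem_map, List.mem_filter] at hv hv'
    grind

theorem length_parameterVars_append_rowVars :
    (parameterVars n ++ rowVars n).length = Nat.card ((Fin n × Fin n) ⊕ (Fin n × Fin n)) :=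
  (Nat.card_fin _).symm.trans <| Nat.card_congr <| List.Nodup.getEquivOfForallMemList _
    (nodup_parameterVars_append_rowVars n) (mem_parameterVars_append_rowVars n)

theorem parameterList_eq_map_shear :
    parameterList K n = (parameterVars n).map fun v => shear K n (X v) := by
  simp only [parameterList, parameterVars, List.map_append, List.map_map]
  refine congrArg₂ _ (congrArg₂ _ ?_ ?_) ?_
  · simp [shearVar, matX]
  · refine List.map_congr_left fun p hp => ?_
    have hp2 : p.2 ≠ 0 := by simpa using (List.mem_filter.1 hp).2
    simp [shearVar, hp2, matY]
  · simp [shearVar, matX, matY, Function.comp_def]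

theorem isWeaklyRegular_parameterList_append_sq : IsWeaklyRegular (PolyRing K n)
    (parameterList K n ++ (List.finRange n).map fun i => matX K n 0 i.rev ^ 2) := by
  have hpow := isWeaklyRegular_X_pow (R := K)
    ((parameterVars n).map (fun v => (v, 1)) ++ (rowVars n).map fun v => (v, 2))
    (by simpa [Function.comp_def] using nodup_parameterVars_append_rowVars n)
  have hshear := (AddEquiv.isWeaklyRegular_congr (e := (shear K n).toRingEquiv.toAddEquiv)
    (List.forall₂_map_right_iff (f := shear K n) |>.2
      (List.forall₂_same.2 fun r _ x => map_mul (shear K n) r x))).1 hpow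
  convert hshear using 1
  rw [parameterList_eq_map_shear]
  simp [rowVars, shearVar, matX, Function.comp_def]

/-! ### Regularity and dimension modulo the anti-diagonal entries -/

variable {K n} {rs : List (PolyRing K n)}

theorem isRegular_antiDiagList_append (hn : 2 ≤ n) (hrs : rs.Perm (parameterList K n)) :
    IsRegular (PolyRing K n) (antiDiagList K n ++ rs) := by
  have hparam : IsWeaklyRegular (PolyRing K n) (parameterList K n ++ antiDiagList K n) := by
    refine isWeaklyRegular_append_of_forall₂_associated_mk
      (isWeaklyRegular_parameterList_append_sq K n) ?_
    rw [antiDiagList, List.forall₂_map_left_iff, List.forall₂_map_right_iff]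
    refine List.forall₂_same.2 fun i _ => ?_
    rw [mk_matX_zero_rev_sq K hn]
    exact (Associated.refl _).neg_left
  have hhom : ∀ f ∈ parameterList K n ++ antiDiagList K n, ∃ d, 0 < d ∧
      f ∈ homogeneousSubmodule ((Fin n × Fin n) ⊕ (Fin n × Fin n)) K d := fun f hf =>
    (List.mem_append.1 hf).elim
      (fun hf => ⟨1, one_pos, isHomogeneous_of_mem_parameterList hf⟩)
      fun hf => ⟨2, two_pos, isHomogeneous_of_mem_antiDiagList hf⟩
  have hperm : (parameterList K n ++ antiDiagList K n).Perm (antiDiagList K n ++ rs) :=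
    List.perm_append_comm.trans (hrs.symm.append_left _)
  let _ := MvPolynomial.gradedAlgebra (σ := (Fin n × Fin n) ⊕ (Fin n × Fin n)) (R := K)
  exact isRegular_self_iff.2
    ⟨isWeaklyRegular_of_perm _ (homogeneousSubmodule _ K) hparam hperm hhom,
      ofList_ne_top_of_homogeneous (homogeneousSubmodule _ K) fun f hf =>
        hhom f (hperm.mem_iff.2 hf)⟩

theorem ringKrullDim_polyRing_eq_length (hrs : rs.Perm (parameterList K n)) :
    ringKrullDim (PolyRing K n) = (antiDiagList K n ++ rs).length := by
  have hlength : (antiDiagList K n ++ rs).length = (parameterVars n ++ rowVars n).length := by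
    simp [antiDiagList, rowVars, hrs.length_eq, parameterList_eq_map_shear, add_comm]
  rw [hlength, length_parameterVars_append_rowVars, MvPolynomial.ringKrullDim_of_isNoetherianRing,
    ringKrullDim_eq_zero_of_field, zero_add]

theorem isRegular_map_mk_antiDiagIdeal (hn : 2 ≤ n) (hrs : rs.Perm (parameterList K n)) :
    IsRegular (PolyRing K n ⧸ antiDiagIdeal K n)
      (rs.map (Ideal.Quotient.mk (antiDiagIdeal K n))) := by
  rw [← ofList_antiDiagList]
  exact isRegular_map_mk_of_append (isRegular_antiDiagList_append hn hrs)

theorem ringKrullDim_quotient_antiDiagIdeal (hn : 2 ≤ n) (hrs : rs.Perm (parameterList K n)) :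
    ringKrullDim (PolyRing K n ⧸ antiDiagIdeal K n) = rs.length := by
  rw [← ofList_antiDiagList]
  exact ringKrullDim_quotient_eq_length_of_append (isRegular_antiDiagList_append hn hrs)
    (ringKrullDim_polyRing_eq_length hrs)

theorem isHomogeneousSystemOfParameters_map_mk (hn : 2 ≤ n) (hrs : rs.Perm (parameterList K n)) :
    IsHomogeneousSystemOfParameters (antiDiagGrading K n)
      (rs.map (Ideal.Quotient.mk (antiDiagIdeal K n))) where
  homogeneous f hf := by
    obtain ⟨g, hg, rfl⟩ := List.mem_map.1 hf
    exact ⟨1, one_pos, g, isHomogeneous_of_mem_parameterList (hrs.mem_iff.1 hg), rfl⟩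
  length_eq := by
    rw [List.length_map]
    exact ringKrullDim_quotient_antiDiagIdeal hn hrs
  dim_quotient := ringKrullDim_quotient_eq_zero (isRegular_map_mk_antiDiagIdeal hn hrs) <| by
    rw [List.length_map]
    exact ringKrullDim_quotient_antiDiagIdeal hn hrs

end Commutator

end CommutatorMatrix

end

open CommutatorMatrix in
theorem mainTheorem11_general (K : Type*) [Field K] (n : ℕ) [NeZero n] (hn : 2 ≤ n) :
    (∀ rs : List (PolyRing K n), rs.Perm (parameterList K n) →
      IsHomogeneousSystemOfParameters (antiDiagGrading K n)
        (rs.map (Ideal.Quotient.mk (antiDiagIdeal K n))) ∧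
      RingTheory.Sequence.IsRegular (PolyRing K n ⧸ antiDiagIdeal K n)
        (rs.map (Ideal.Quotient.mk (antiDiagIdeal K n)))) ∧
    ∃ φ : (PolyRing K n ⧸ Ideal.ofList (parameterList K n)) ≃ₐ[K] MvPolynomial (Fin n) K,
      (∀ j : Fin n, φ (Ideal.Quotient.mk _ (matX K n 0 j)) = MvPolynomial.X j) ∧
      ((antiDiagIdeal K n).map (Ideal.Quotient.mk (Ideal.ofList (parameterList K n)))).map φ =
        Ideal.span (Set.range fun j : Fin n => (MvPolynomial.X j : MvPolynomial (Fin n) K) ^ 2) :=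
  ⟨fun _ hrs => ⟨isHomogeneousSystemOfParameters_map_mk hn hrs,
      isRegular_map_mk_antiDiagIdeal hn hrs⟩,
    parameterQuotientEquiv K n, fun j => by simp, map_parameterQuotientEquiv_antiDiagIdeal K hn⟩

open CommutatorMatrix in
theorem mainTheorem11 (K : Type*) [Field K] (n : ℕ) [NeZero n] (hn : 3 ≤ n) :
    (∀ rs : List (PolyRing K n), rs.Perm (parameterList K n) →
      IsHomogeneousSystemOfParameters (antiDiagGrading K n)
        (rs.map (Ideal.Quotient.mk (antiDiagIdeal K n))) ∧
      RingTheory.Sequence.IsRegular (PolyRing K n ⧸ antiDiagIdeal K n)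
        (rs.map (Ideal.Quotient.mk (antiDiagIdeal K n)))) ∧
    ∃ φ : (PolyRing K n ⧸ Ideal.ofList (parameterList K n)) ≃ₐ[K] MvPolynomial (Fin n) K,
      (∀ j : Fin n, φ (Ideal.Quotient.mk _ (matX K n 0 j)) = MvPolynomial.X j) ∧
      ((antiDiagIdeal K n).map (Ideal.Quotient.mk (Ideal.ofList (parameterList K n)))).map φ =
        Ideal.span (Set.range fun j : Fin n => (MvPolynomial.X j : MvPolynomial (Fin n) K) ^ 2) :=
  mainTheorem11_general K n (by omega)
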